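/- **Theorem 3.1.** Let $d\ge 1$, let $\mathcal S$ be the real Schwartz space on $\mathbb R^d$, and let $\mathcal S'$ be its dual, with the weak topology and its Borel $\sigma$-algebra. Let $z\ge 0$, let $r$ be a probability measure on $\mathbb R$ with $r\{0\}=0$ and $\operatorname{supp} r\subseteq[-c,c]$ for some $c>0$, and put $\psi(t)=z\int_{\mathbb R}(e^{ist}-1)\,dr(s)$. Let $F$ be the Poisson white noise with activity $z$ and Lévy measure $r$, i.e. the coordinate process $F(f)(\omega)=\omega(f)$ on $(\mathcal S',P^F)$, where $P^F$ is a probability measure on $\mathcal S'$ with $\int e^{i\omega(f)}\,dP^F(\omega)=\exp\left(\int_{\mathbb R^d}\psi(f(x))\,dx\right)$ for all $f\in\mathcal S$. Let $G\in L^1(\mathbb R^d,dx)$ be real valued, and for $f\in\mathcal S$ put $(\check G*f)(x)=\int_{\mathbb R^d} G(y)f(x+y)\,dy$. The convoluted Poisson noise $X=G*F$ is the random field on $(\mathcal S',P^F)$ given by $X(f)=F(\check G*f)$, $f\in\mathcal S$, where the right-hand side is the limit in probability of $F(u_n)$ along every sequence $u_n\in\mathcal S$ with $u_n\to\check G*f$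 in $L^1(\mathbb R^d,dx)$. A law of $X$ is a probability measure $P^X$ on $\mathcal S'$ with $\int e^{i\omega(f)}\,dP^X(\omega)=\mathbb E[e^{iX(f)}]$ for all $f\in\mathcal S$. For $\varepsilon>0$ let $g_\varepsilon(x)=(1+|x|^2)^{-(d+\varepsilon)/2}$, and regard $L^1(\mathbb R^d,g_\varepsilon dx)$ as a subset of $\mathcal S'$ via $h\mapsto\left(f\mapsto\int hf\,dx\right)$. Then: 1. The field $X=G*F$ exists and has a version that is a measurable map $\mathcal S'\to\mathcal S'$. 2. For every law $P^X$ of $X$ and every $\varepsilon>0$, $X$ has paths in $L^1(\mathbb R^d,g_\varepsilon dx)$, i.e. this set has $P^X$ inner measure one: $\sup\{P^X(B): B \text{ measurable},\ B\subseteq L^1(\mathbb R^d,g_\varepsilon dx)\}=1$. 3. If $\omega\mapsto G*\omega$ is defined on all of $\mathcal S'$, i.e. $\check G*f\in\mathcal S$ for all $f\in\mathcal S$ and there is a map $K:\mathcal S'\to\mathcal S'$ with $(K\omega)(f)=\omega(\check G*f)$ (for example $K=L^{-1}$ when $G$ is the Green's function of a continuously invertible linear operator $L$ on $\mathcal S'$),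 then $K$ is measurable, the pathwise convolution $\omega\mapsto K\omega$ is a version of $X=G*F$, and its law $P^F\circ K^{-1}$ gives $L^1(\mathbb R^d,g_\varepsilon dx)$ inner measure one for every $\varepsilon>0$. 4. For every $\varepsilon>0$, every element of $L^1(\mathbb R^d,g_\varepsilon dx)\subset\mathcal S'$ is given by a locally integrable function. -/

import Mathlib

open MeasureTheory Filter Topology Set
open scoped SchwartzMap

noncomputable section

namespace PoissonNoise

/-- `d`-dimensional Euclidean space. -/
abbrev Space (d : ℕ) : Type := EuclideanSpace ℝ (Fin d)

/-- Real valued Schwartz test functions. -/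
abbrev TestFn (d : ℕ) : Type := 𝓢(Space d, ℝ)

/-- Real tempered distributions, with the weak topology (pointwise convergence on test
functions). -/
abbrev Tempered (d : ℕ) : Type := TestFn d →Lₚₜ[ℝ] ℝ

/-- The Borel `σ`-algebra of the weak topology on the tempered distributions. -/
instance instMeasurableSpaceTempered (d : ℕ) : MeasurableSpace (Tempered d) :=
  borel (Tempered d)

instance instBorelSpaceTempered (d : ℕ) : BorelSpace (Tempered d) := ⟨rfl⟩

/-- The pure Poisson Lévy characteristic `ψ(t) = z ∫ (e^{ist} - 1) dr(s)` with activity `z` and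
Lévy measure `r`. -/
def poissonCharacteristic (z : ℝ) (r : Measure ℝ) (t : ℝ) : ℂ :=
  (z : ℂ) * ∫ s, (Complex.exp (Complex.I * ((s * t : ℝ) : ℂ)) - 1) ∂r

/-- `P` is the law, on the tempered distributions, of the Poisson white noise `F` with activity `z`
and Lévy measure `r`: it is a probability measure with characteristic functional
`E[e^{iF(f)}] = exp (∫ ψ(f(x)) dx)`. The noise `F` itself is the coordinate process
`F(f)(ω) = ω(f)`. -/
def IsPoissonWhiteNoise {d : ℕ} (z : ℝ) (r : Measure ℝ) (P : Measure (Tempered d)) : Prop :=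
  IsProbabilityMeasure P ∧
    ∀ f : TestFn d,
      ∫ ω, Complex.exp (Complex.I * ((ω f : ℝ) : ℂ)) ∂P =
        Complex.exp (∫ x, poissonCharacteristic z r (f x))

/-- Convolution of `f` with the reflected kernel `x ↦ G (-x)`. This is the action on test functions
dual to convolution with `G`, that is `⟨G * ω, f⟩ = ⟨ω, dualConv G f⟩`. -/
def dualConv {d : ℕ} (G : Space d → ℝ) (f : TestFn d) (x : Space d) : ℝ :=
  ∫ y, G y * f (x + y)

/-- `K` is the operator `ω ↦ G * ω` on tempered distributions: convolution with the reflected kernel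
maps test functions to test functions, and `⟨K ω, f⟩ = ⟨ω, dualConv G f⟩`. If `G` is the Green's
function of an invertible operator `L` on tempered distributions, this is `K = L⁻¹`. -/
def IsConvolutionOperator {d : ℕ} (G : Space d → ℝ) (K : Tempered d → Tempered d) : Prop :=
  ∀ f : TestFn d, ∃ h : TestFn d, (∀ x, h x = dualConv G f x) ∧ ∀ ω, K ω f = ω h

/-- `X` is a version of the random field `G * F`, for `F` the coordinate process under `P` and `G` an
arbitrary integrable kernel: `X(f) = F(dualConv G f)`, where `F` is evaluated at the integrable (but
in general not Schwartz) function `dualConv G f` as a limit in probability, along every sequence of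
test functions that converges to it in `L¹(dx)`. -/
def IsConvolutedField {d : ℕ} (G : Space d → ℝ) (P : Measure (Tempered d))
    (X : TestFn d → Tempered d → ℝ) : Prop :=
  ∀ f : TestFn d, AEMeasurable (X f) P ∧
    ∀ u : ℕ → TestFn d,
      Tendsto (fun n => eLpNorm (fun x => u n x - dualConv G f x) 1 volume) atTop (𝓝 0) →
        TendstoInMeasure P (fun n ω => ω (u n)) atTop (X f)

/-- The probability measure `Q` on the tempered distributions is the law of the random field `X`
defined on the tempered distributions with the measure `P`: the characteristic functionals agree. -/
def IsLawOfField {d : ℕ} (P : Measure (Tempered d)) (X : TestFn d → Tempered d → ℝ)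
    (Q : Measure (Tempered d)) : Prop :=
  IsProbabilityMeasure Q ∧
    ∀ f : TestFn d,
      ∫ η, Complex.exp (Complex.I * ((η f : ℝ) : ℂ)) ∂Q =
        ∫ ω, Complex.exp (Complex.I * ((X f ω : ℝ) : ℂ)) ∂P

/-- A random field with law `Q` has paths in `E`: the set `E` has `Q` inner measure one. -/
def HasPathsIn {d : ℕ} (Q : Measure (Tempered d)) (E : Set (Tempered d)) : Prop :=
  ⨆ (B : Set (Tempered d)) (_ : MeasurableSet B) (_ : B ⊆ E), Q B = 1

/-- The tempered distribution `ω` is given by the function `h`. -/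
def IsRepresentedBy {d : ℕ} (ω : Tempered d) (h : Space d → ℝ) : Prop :=
  ∀ f : TestFn d, Integrable (fun x => h x * f x) ∧ ω f = ∫ x, h x * f x

/-- The weight `g_ε(x) = (1 + |x|²)^{-(d+ε)/2}`. -/
def weight (d : ℕ) (ε : ℝ) (x : Space d) : ℝ :=
  (1 + ‖x‖ ^ 2) ^ (-((d : ℝ) + ε) / 2)

/-- `L¹(ℝ^d, g_ε dx)` as a subset of the tempered distributions. -/
def weightedL1 (d : ℕ) (ε : ℝ) : Set (Tempered d) :=
  {ω | ∃ h : Space d → ℝ,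
    Integrable h (volume.withDensity fun x => ENNReal.ofReal (weight d ε x)) ∧
      IsRepresentedBy ω h}

end PoissonNoise

end

/-!
The proof rests on a first moment bound. The Poisson noise is formally
`F(u) = ∫∫ s u(x) N(ds, dx)` for a Poisson random measure `N` with intensity `z r ⊗ dx`, so that
`E|F(u)| ≤ z ∫|s| dr ‖u‖₁ ≤ z c ‖u‖₁`. Since only the characteristic functional of `F` is given, the
bound is derived from it, by writing the law of `F(u)` as a weak limit of convolution powers
(`lintegral_enorm_le_of_charFun_eq_exp`). Hence `F` extends to a bounded operator
`T : L¹(dx) → L¹(P)` (`IsPoissonWhiteNoise.exists_extension`), and the versions of `G * F` are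
exactly the processes with `X(f) = T(Ǧ * f)` almost surely (`isConvolutedField_iff`).

Now `Ǧ * f = ∫ f(x) G(x - ·) dx` is a superposition of the reflected translates of `G`, which form a
bounded continuous family in `L¹(dx)`. So `X(f) = ∫ f(x) h(x) dx` with `h(x) = T(G(x - ·))`, a
bounded continuous map into `L¹(P)`. It has a jointly measurable version `h(x, ω)`
(`exists_measurable_version`), and by Fubini's theorem `h(·, ω)` is in `L¹(g_ε dx)` for almost every
`ω`, because `g_ε` is integrable. The distribution with density `h(·, ω)` is the required random
distribution; it is Borel measurable because it factors through the separable space `L¹(g_ε dx)`.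

The same argument works under an arbitrary law `Q` of `X`. There the coordinate process is bounded
in `L¹(Q)` by `‖T‖ ‖Ǧ * f‖₁` only, so it extends to the closed span of the functions `Ǧ * f`; that span
contains all reflected translates of `G`, and there is again a jointly measurable density
(`exists_density`). As the Schwartz space is separable (`secondCountableTopology_schwartz`), the
distributions that agree with their density on a countable dense set of test functions form a
measurable subset of `L¹(g_ε dx)` of full measure.
-/

noncomputable section

namespace PoissonNoise

/-! ### Separability of the Schwartz space -/

/-- Functions vanishing at infinity on a second countable locally compact space form a second
countable space: the sets of functions that are at most `ε` off a fixed compact set are separable for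
the compact-open topology, and on such a set compact convergence controls the sup norm up to `ε`. -/
theorem secondCountableTopology_zeroAtInfty {X E : Type*} [TopologicalSpace X]
    [SecondCountableTopology X] [LocallyCompactSpace X] [NormedAddCommGroup E] [SecondCountableTopology E] :
    SecondCountableTopology (ZeroAtInftyContinuousMap X E) := by
  refine Metric.secondCountable_of_almost_dense_set fun ε hε => ?_
  let K := CompactExhaustion.choice X
  let S : ℕ → Set (ZeroAtInftyContinuousMap X E) := fun n => {f | ∀ x ∉ K n, ‖f x‖ ≤ ε / 2}
  let A : ℕ → Set C(X, E) := fun n =>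
    (fun f : ZeroAtInftyContinuousMap X E => f.toContinuousMap) '' S n
  choose c hc hcd using fun n => TopologicalSpace.exists_countable_dense (A n)
  have hpre : ∀ n (g : A n), ∃ f ∈ S n, f.toContinuousMap = g.1 := fun n g => g.2
  choose φ hφS hφ using hpre
  refine ⟨⋃ n, φ n '' c n, countable_iUnion fun n => (hc n).image _, fun f => ?_⟩
  obtain ⟨n, hn⟩ : ∃ n, f ∈ S n := by
    have h1 := (zero_at_infty f).eventually (Metric.closedBall_mem_nhds (0 : E) (half_pos hε))
    rw [Filter.Eventually, Filter.mem_cocompact] at h1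
    obtain ⟨t, ht, hts⟩ := h1
    obtain ⟨n, hn⟩ := K.exists_superset_of_isCompact ht
    refine ⟨n, fun x hx => ?_⟩
    have := hts (fun h => hx (hn h))
    simpa using this
  have h2 : ∀ᶠ g in 𝓝 f.toContinuousMap, ∀ x ∈ K n, dist (f x) (g x) < ε := by
    have := ContinuousMap.tendsto_iff_forall_isCompact_tendstoUniformlyOn.mp
      (tendsto_id (x := 𝓝 f.toContinuousMap)) (K n) (K.isCompact n)
    exact Metric.tendstoUniformlyOn_iff.mp this ε hε
  let F : A n := ⟨f.toContinuousMap, f, hn, rfl⟩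
  have h3 : ∀ᶠ g in 𝓝 F, ∀ x ∈ K n, dist (f x) (g.1 x) < ε :=
    (continuous_subtype_val.tendsto F).eventually h2
  obtain ⟨g, hg, hgc⟩ := (mem_closure_iff_nhds.mp (hcd n F)) _ h3
  refine ⟨φ n g, mem_iUnion.2 ⟨n, g, hgc, rfl⟩, ?_⟩
  rw [← ZeroAtInftyContinuousMap.dist_toBCF_eq_dist, BoundedContinuousFunction.dist_le hε.le]
  intro x
  by_cases hx : x ∈ K n
  · have := (hg x hx).le
    rw [← hφ n g] at this
    exact this
  · have h4 := hn x hx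
    have h5 := hφS n g x hx
    calc dist (f x) (φ n g x) ≤ ‖f x‖ + ‖φ n g x‖ := by rw [dist_eq_norm]; exact norm_sub_le _ _
      _ ≤ ε := by linarith

/-- The weighted derivative `x ↦ ‖x‖ ^ k • D ^ n f x` of a Schwartz function, whose sup norm is the
seminorm of order `(k, n)`. -/
def weightedDeriv (V : Type*) [NormedAddCommGroup V] [NormedSpace ℝ V] [FiniteDimensional ℝ V]
    (k n : ℕ) : 𝓢(V, ℝ) →ₗ[ℝ] ZeroAtInftyContinuousMap V (V [×n]→L[ℝ] ℝ) where
  toFun f :=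
    { toFun := fun x => ‖x‖ ^ k • iteratedFDeriv ℝ n f x
      continuous_toFun := (continuous_norm.pow k).smul
        ((f.smooth ⊤).continuous_iteratedFDeriv (mod_cast le_top))
      zero_at_infty' := by
        have : ProperSpace V := FiniteDimensional.proper ℝ V
        obtain ⟨C, -, hC⟩ := f.decay (k + 1) n
        have h0 : Tendsto (fun x : V => C * ‖x‖⁻¹) (cocompact V) (𝓝 0) := by
          simpa using (tendsto_norm_cocompact_atTop (E := V)).inv_tendsto_atTop.const_mul C
        refine squeeze_zero_norm' ?_ h0
        filter_upwards [(tendsto_norm_cocompact_atTop (E := V)).eventually_gt_atTop 0] with x hx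
        rw [norm_smul, norm_pow, norm_norm, ← div_eq_mul_inv, le_div_iff₀ hx]
        calc _ = ‖x‖ ^ (k + 1) * ‖iteratedFDeriv ℝ n f x‖ := by ring
          _ ≤ C := hC x }
  map_add' f g := by
    ext1 x
    have := iteratedFDeriv_add (𝕜 := ℝ) (i := n) (f := f) (g := g) ((f.smooth n)) (g.smooth n)
    simp [this, smul_add]
  map_smul' a f := by
    ext1 x
    have := iteratedFDeriv_const_smul_apply (𝕜 := ℝ) (i := n) (a := a) (x := x)
      (f := f) (f.smooth n).contDiffAt
    change ‖x‖ ^ k • iteratedFDeriv ℝ n (a • (f : V → ℝ)) x = a • (‖x‖ ^ k • iteratedFDeriv ℝ n f x)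
    rw [this, smul_comm]

theorem norm_weightedDeriv {V : Type*} [NormedAddCommGroup V] [NormedSpace ℝ V]
    [FiniteDimensional ℝ V] (k n : ℕ) (f : 𝓢(V, ℝ)) :
    ‖weightedDeriv V k n f‖ = SchwartzMap.seminorm ℝ k n f := by
  have hval : ∀ x, ‖weightedDeriv V k n f x‖ = ‖x‖ ^ k * ‖iteratedFDeriv ℝ n f x‖ := fun x => by
    change ‖‖x‖ ^ k • iteratedFDeriv ℝ n f x‖ = _
    rw [norm_smul, norm_pow, norm_norm]
  apply le_antisymm
  · rw [← ZeroAtInftyContinuousMap.norm_toBCF_eq_norm,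
      BoundedContinuousFunction.norm_le (apply_nonneg _ _)]
    intro x
    refine (hval x).le.trans (SchwartzMap.le_seminorm ℝ k n f x)
  · refine SchwartzMap.seminorm_le_bound ℝ k n f (norm_nonneg (weightedDeriv V k n f)) fun x => ?_
    rw [← hval, ← ZeroAtInftyContinuousMap.norm_toBCF_eq_norm]
    exact BoundedContinuousFunction.norm_coe_le_norm
      (ZeroAtInftyContinuousMap.toBCF (weightedDeriv V k n f)) x

/-- The topology of the Schwartz space is induced by countably many maps into separable normed
spaces, the weighted derivatives. -/
instance secondCountableTopology_schwartz (V : Type*) [NormedAddCommGroup V] [NormedSpace ℝ V]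
    [FiniteDimensional ℝ V] : SecondCountableTopology 𝓢(V, ℝ) := by
  have : ProperSpace V := FiniteDimensional.proper ℝ V
  have h := (SeminormFamily.withSeminorms_iff_topologicalSpace_eq_iInf _).mp
    (schwartz_withSeminorms ℝ V ℝ)
  have hfin : ∀ n, FiniteDimensional ℝ (V [×n]→L[ℝ] ℝ) := fun n =>
    Module.Finite.of_injective
      (ContinuousMultilinearMap.toMultilinearMapLinear :
        (V [×n]→L[ℝ] ℝ) →ₗ[ℝ] MultilinearMap ℝ (fun _ : Fin n => V) ℝ)
      ContinuousMultilinearMap.toMultilinearMap_injective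
  have key : ∀ i : ℕ × ℕ, @SecondCountableTopology 𝓢(V, ℝ)
      (schwartzSeminormFamily ℝ V ℝ
        i).toSeminormedAddCommGroup.toUniformSpace.toTopologicalSpace := by
    rintro ⟨k, n⟩
    have : ProperSpace (V [×n]→L[ℝ] ℝ) := FiniteDimensional.proper ℝ _
    have := secondCountableTopology_zeroAtInfty (X := V) (E := V [×n]→L[ℝ] ℝ)
    have hd : ∀ f g : 𝓢(V, ℝ), dist (weightedDeriv V k n f) (weightedDeriv V k n g) =
        SchwartzMap.seminorm ℝ k n (f - g) := fun f g => by
      rw [← norm_weightedDeriv, map_sub]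
      exact dist_eq_norm (weightedDeriv V k n f) (weightedDeriv V k n g)
    let p := (schwartzSeminormFamily ℝ V ℝ (k, n)).toSeminormedAddCommGroup
    have hiso : @Isometry _ _ p.toPseudoMetricSpace.toPseudoEMetricSpace _
        (weightedDeriv V k n) := by
      refine @Isometry.of_dist_eq _ _ p.toPseudoMetricSpace _ _ fun f g => ?_
      exact (hd f g).trans (@dist_eq_norm _ p f g).symm
    exact @IsInducing.secondCountableTopology _ _ p.toUniformSpace.toTopologicalSpace _ _ _
      (@IsUniformInducing.isInducing _ _ p.toUniformSpace _ _
        (@Isometry.isUniformInducing _ _ p.toPseudoMetricSpace.toPseudoEMetricSpace _ _ hiso))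
  rw [h]
  exact TopologicalSpace.secondCountableTopology_iInf key

/-! ### First moments of compound Poisson laws -/

open scoped ENNReal NNReal in
/-- The law of a sum of `n` independent copies of a real random variable. -/
theorem exists_charFun_eq_pow (μ : Measure ℝ) [IsProbabilityMeasure μ] (n : ℕ) :
    ∃ ν : Measure ℝ, IsProbabilityMeasure ν ∧ (∀ t, charFun ν t = charFun μ t ^ n) ∧
      ∫⁻ x, ‖x‖ₑ ∂ν ≤ n * ∫⁻ x, ‖x‖ₑ ∂μ := by
  induction n with
  | zero => exact ⟨Measure.dirac 0, inferInstance, fun t => by simp [charFun_dirac], by simp⟩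
  | succ n ih =>
    obtain ⟨ν, hν, hchar, hmom⟩ := ih
    refine ⟨ν.conv μ, inferInstance, fun t => by rw [charFun_conv, hchar, pow_succ], ?_⟩
    rw [Measure.lintegral_conv (by fun_prop)]
    calc ∫⁻ x, ∫⁻ y, ‖x + y‖ₑ ∂μ ∂ν ≤ ∫⁻ x, ∫⁻ y, (‖x‖ₑ + ‖y‖ₑ) ∂μ ∂ν :=
          lintegral_mono fun x => lintegral_mono fun y => enorm_add_le x y
      _ = ∫⁻ x, ‖x‖ₑ ∂ν + ∫⁻ y, ‖y‖ₑ ∂μ := by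
          simp_rw [lintegral_add_left measurable_const, lintegral_const, measure_univ, mul_one]
          rw [lintegral_add_right _ measurable_const, lintegral_const, measure_univ, mul_one]
      _ ≤ _ := by push_cast; rw [add_mul, one_mul]; gcongr

theorem norm_exp_mul_I_sub_one_le (x : ℝ) : ‖Complex.exp (x * Complex.I) - 1‖ ≤ |x| := by
  have := Real.norm_exp_I_mul_ofReal_sub_one_le (x := x)
  rwa [mul_comm] at this

open scoped ENNReal NNReal in
/-- A measure of total mass at most `n`, divided by `n` and completed to a probability measure by an
atom at the origin. -/
theorem exists_charFun_eq_one_add {α : Type*} [MeasurableSpace α] (m : Measure α)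
    {n : ℕ} (hn : n ≠ 0) (hm : m univ ≤ n) {y : α → ℝ} (hy : Measurable y) :
    ∃ μ : Measure ℝ, IsProbabilityMeasure μ ∧
      (∀ t : ℝ, charFun μ t =
        1 + (n : ℂ)⁻¹ * ∫ a, (Complex.exp ((t * y a : ℝ) * Complex.I) - 1) ∂m) ∧
      n * ∫⁻ x, ‖x‖ₑ ∂μ = ∫⁻ a, ‖y a‖ₑ ∂m := by
  have hn0 : (n : ℝ≥0∞) ≠ 0 := by exact_mod_cast hn
  have hnt : (n : ℝ≥0∞) ≠ ∞ := ENNReal.natCast_ne_top n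
  have hfin : IsFiniteMeasure m := ⟨hm.trans_lt (ENNReal.natCast_lt_top n)⟩
  let κ : ℝ≥0∞ := (n : ℝ≥0∞)⁻¹ * m univ
  have hκ : κ ≤ 1 := by
    calc κ ≤ (n : ℝ≥0∞)⁻¹ * n := mul_le_mul_right hm _
      _ = 1 := ENNReal.inv_mul_cancel hn0 hnt
  let μ : Measure ℝ := (1 - κ) • Measure.dirac 0 + (n : ℝ≥0∞)⁻¹ • m.map y
  have hmap : m.map y univ = m univ := by rw [Measure.map_apply hy .univ, preimage_univ]
  have h1 : IsFiniteMeasure ((1 - κ) • Measure.dirac (0 : ℝ)) :=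
    Measure.smul_finite _ (ENNReal.sub_ne_top ENNReal.one_ne_top)
  have h2 : IsFiniteMeasure ((n : ℝ≥0∞)⁻¹ • m.map y) :=
    Measure.smul_finite _ (ENNReal.inv_ne_top.2 hn0)
  refine ⟨μ, ⟨?_⟩, fun t => ?_, ?_⟩
  · simp only [μ, Measure.add_apply, Measure.smul_apply, measure_univ, smul_eq_mul, mul_one, hmap]
    exact tsub_add_cancel_of_le hκ
  · have hb : ∀ ν : Measure ℝ, IsFiniteMeasure ν →
        Integrable (fun x : ℝ => Complex.exp (t * x * Complex.I)) ν := fun ν _ =>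
      (integrable_const (1 : ℝ)).mono (by fun_prop) (.of_forall fun x => by
        rw [← Complex.ofReal_mul, Complex.norm_exp_ofReal_mul_I]; simp)
    have hb' : Integrable (fun a => Complex.exp ((t * y a : ℝ) * Complex.I)) m :=
      (integrable_const (1 : ℝ)).mono (by fun_prop) (.of_forall fun x => by
        rw [Complex.norm_exp_ofReal_mul_I]; simp)
    rw [charFun_apply_real, integral_add_measure (hb _ h1) (hb _ h2), integral_smul_measure,
      integral_smul_measure, integral_map hy.aemeasurable (by fun_prop),
      integral_sub hb' (integrable_const _)]
    simp only [integral_dirac, integral_const]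
    rw [ENNReal.toReal_sub_of_le hκ ENNReal.one_ne_top]
    simp [κ, Measure.real]
    ring
  · simp only [μ, lintegral_add_measure, lintegral_smul_measure, lintegral_dirac, enorm_zero,
      smul_eq_mul, mul_zero, zero_add]
    rw [lintegral_map (by fun_prop) hy, ← mul_assoc, ENNReal.mul_inv_cancel hn0 hnt, one_mul]

open scoped ENNReal NNReal in
/-- **First moment of a compound Poisson law**. If the characteristic function of `ν` is
`exp (∫ (e^{ity} - 1) dm)`, then `ν` is the law of `∫ y dN` for a Poisson random measure `N` with
intensity `m`, whence the bound. The intensity may be infinite: it is approximated by the measures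
`κₙ m` of mass at most `n`, and `ν` is the weak limit of the `n`-fold convolutions of the laws
`(1 - m_n / n) δ₀ + m_n / n`, where `m_n` is the image of `κₙ m` under `y`. -/
theorem lintegral_enorm_le_of_charFun_eq_exp {α : Type*} [MeasurableSpace α] (m : Measure α)
    [SigmaFinite m] {y : α → ℝ} (hy : Measurable y) (hym : Integrable y m) (ν : Measure ℝ)
    [IsProbabilityMeasure ν]
    (hν : ∀ t : ℝ, charFun ν t =
      Complex.exp (∫ a, (Complex.exp ((t * y a : ℝ) * Complex.I) - 1) ∂m)) :
    ∫⁻ x, ‖x‖ₑ ∂ν ≤ ∫⁻ a, ‖y a‖ₑ ∂m := by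
  -- `κ n = min 1 (n g)` has integral at most `n` and is eventually equal to `1` at every point.
  obtain ⟨g, hg0, hgm, hg1⟩ := exists_pos_lintegral_lt_of_sigmaFinite m one_ne_zero
  let κ : ℕ → α → ℝ≥0 := fun n a => min 1 (n * g a)
  have hκm : ∀ n, Measurable (κ n) := fun n => measurable_const.min (hgm.const_mul _)
  have hκ1 : ∀ n a, κ n a ≤ 1 := fun n a => min_le_left _ _
  let m' : ℕ → Measure α := fun n => m.withDensity fun a => κ n a
  have hm' : ∀ n, m' n univ ≤ n := fun n => by
    rw [withDensity_apply _ .univ, Measure.restrict_univ]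
    calc ∫⁻ a, κ n a ∂m ≤ ∫⁻ a, n * g a ∂m := lintegral_mono fun a => by
          have : κ n a ≤ n * g a := min_le_right _ _
          calc (κ n a : ℝ≥0∞) ≤ ((n * g a : ℝ≥0) : ℝ≥0∞) := ENNReal.coe_le_coe.2 this
            _ = n * g a := by push_cast; rfl
      _ = n * ∫⁻ a, g a ∂m := lintegral_const_mul _ (by fun_prop)
      _ ≤ n := mul_le_of_le_one_right' hg1.le
  have hm'le : ∀ n, m' n ≤ m := fun n => by
    conv_rhs => rw [← withDensity_one (μ := m)]
    exact withDensity_mono (.of_forall fun a => by simpa using hκ1 n a)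
  choose μ hμ hμc hμm using fun n : ℕ =>
    exists_charFun_eq_one_add (m' (n + 1)) n.succ_ne_zero (hm' (n + 1)) hy
  choose ρ hρ hρc hρm using fun n : ℕ => exists_charFun_eq_pow (μ n) (n + 1)
  have hlim : ∀ t : ℝ, Tendsto (fun n => charFun (ρ n) t) atTop (𝓝 (charFun ν t)) := by
    intro t
    let A : ℕ → ℂ := fun n => ∫ a, (Complex.exp ((t * y a : ℝ) * Complex.I) - 1) ∂(m' n)
    have hA : Tendsto A atTop
        (𝓝 (∫ a, (Complex.exp ((t * y a : ℝ) * Complex.I) - 1) ∂m)) := by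
      simp only [A, m']
      simp_rw [integral_withDensity_eq_integral_smul (hκm _)]
      refine tendsto_integral_of_dominated_convergence (fun a => |t * y a|)
        (fun n => by fun_prop) (hym.const_mul t).abs (fun n => .of_forall fun a => ?_)
        (.of_forall fun a => ?_)
      · rw [NNReal.smul_def, norm_smul]
        refine le_trans (mul_le_of_le_one_left (norm_nonneg _) ?_) (norm_exp_mul_I_sub_one_le _)
        simpa using hκ1 n a
      · have : ∀ᶠ n in atTop, κ n a = 1 := by
          have h := (tendsto_natCast_atTop_atTop (R := ℝ≥0)).atTop_mul_const (hg0 a)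
          filter_upwards [h.eventually_ge_atTop 1] with n hn using min_eq_left hn
        refine tendsto_const_nhds.congr' ?_
        filter_upwards [this] with n hn
        rw [hn, one_smul]
    have hpow := Complex.tendsto_one_add_pow_exp_of_tendsto (g := fun n => (n : ℂ)⁻¹ * A n)
      (hA.congr' (by
        filter_upwards [eventually_ne_atTop 0] with n hn
        rw [mul_inv_cancel_left₀ (by exact_mod_cast hn)]))
    rw [hν]
    refine (hpow.comp (tendsto_add_atTop_nat 1)).congr fun n => ?_
    rw [hρc, hμc]
    rfl
  have hweak := ProbabilityMeasure.tendsto_of_tendsto_charFun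
    (μ := fun n => ⟨ρ n, hρ n⟩) (μ₀ := ⟨ν, inferInstance⟩) hlim
  have hport := lintegral_le_liminf_lintegral_of_forall_isOpen_measure_le_liminf_measure
    (μ := ν) (μs := ρ) (f := fun x => ‖x‖) continuous_norm (fun x => norm_nonneg x)
    fun G hG => ProbabilityMeasure.le_liminf_measure_open_of_tendsto hweak hG
  simp only [ofReal_norm] at hport
  refine hport.trans (liminf_le_of_le (by isBoundedDefault) fun b hb => ?_)
  obtain ⟨n, hn⟩ := hb.exists
  calc b ≤ _ := hn
    _ ≤ ((n + 1 : ℕ) : ℝ≥0∞) * ∫⁻ x, ‖x‖ₑ ∂(μ n) := hρm n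
    _ = ∫⁻ a, ‖y a‖ₑ ∂(m' (n + 1)) := hμm n
    _ ≤ _ := lintegral_mono' (hm'le _) le_rfl

theorem continuous_tempered_apply {d : ℕ} (f : TestFn d) : Continuous fun ω : Tempered d => ω f :=
  (PointwiseConvergenceCLM.evalCLM (RingHom.id ℝ) ℝ f).continuous

theorem measurable_tempered_apply {d : ℕ} (f : TestFn d) : Measurable fun ω : Tempered d => ω f :=
  (continuous_tempered_apply f).measurable

open scoped ENNReal in
/-- The Poisson noise is bounded from `L¹(dx)` to `L¹(P)` on test functions. -/
theorem IsPoissonWhiteNoise.lintegral_enorm_le {d : ℕ} {z : ℝ} (hz : 0 ≤ z) {r : Measure ℝ}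
    (hr : IsProbabilityMeasure r) {c : ℝ} (hrc : r.support ⊆ Set.Icc (-c) c)
    {P : Measure (Tempered d)} (hP : IsPoissonWhiteNoise z r P) (u : TestFn d) :
    ∫⁻ ω, ‖ω u‖ₑ ∂P ≤ ENNReal.ofReal (z * c) * ∫⁻ x, ‖u x‖ₑ := by
  have := hP.1
  have hbd : ∀ᵐ s ∂r, |s| ≤ c := by
    filter_upwards [Measure.support_mem_ae (μ := r)] with s hs
    exact abs_le.mpr (hrc hs)
  have hsint : Integrable (fun s : ℝ => s) r :=
    (integrable_const c).mono' (by fun_prop) hbd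
  -- The intensity of the Poisson random measure of jumps `s` at positions `x`.
  let m : Measure (ℝ × Space d) := (ENNReal.ofReal z • r).prod volume
  have hy : Measurable fun a : ℝ × Space d => a.1 * u a.2 :=
    measurable_fst.mul (u.continuous.measurable.comp measurable_snd)
  have hfin : IsFiniteMeasure (ENNReal.ofReal z • r) := Measure.smul_finite _ ENNReal.ofReal_ne_top
  have hint : Integrable (fun a : ℝ × Space d => a.1 * u a.2) m :=
    (hsint.smul_measure ENNReal.ofReal_ne_top).mul_prod u.integrable
  have hmap : IsProbabilityMeasure (P.map fun ω => ω u) :=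
    Measure.isProbabilityMeasure_map (measurable_tempered_apply u).aemeasurable
  have key := lintegral_enorm_le_of_charFun_eq_exp m hy hint (P.map fun ω => ω u) fun t => by
    rw [charFun_apply_real, integral_map (measurable_tempered_apply u).aemeasurable (by fun_prop)]
    have h := hP.2 (t • u)
    have e1 : ∀ ω : Tempered d, Complex.exp (t * (ω u : ℝ) * Complex.I) =
        Complex.exp (Complex.I * ((ω (t • u) : ℝ) : ℂ)) := fun ω => by
      rw [map_smul, smul_eq_mul]; push_cast; ring_nf
    simp_rw [e1, h]
    have hi : Integrable (fun a : ℝ × Space d =>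
        Complex.exp ((t * (a.1 * u a.2) : ℝ) * Complex.I) - 1) m :=
      (hint.const_mul t).mono (by fun_prop) (.of_forall fun a => norm_exp_mul_I_sub_one_le _)
    rw [integral_prod_symm _ hi]
    congr 1
    refine integral_congr_ae (.of_forall fun x => ?_)
    simp only [poissonCharacteristic]
    rw [integral_smul_measure, ENNReal.toReal_ofReal hz, Complex.real_smul]
    congr 2
    ext s
    congr 2
    simp only [_root_.smul_apply, smul_eq_mul]
    push_cast
    ring
  rw [lintegral_map (by fun_prop) (measurable_tempered_apply u)] at key
  refine key.trans ?_
  simp only [enorm_mul, m]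
  rw [lintegral_prod_mul (by fun_prop) (u.continuous.measurable.enorm.aemeasurable),
    lintegral_smul_measure, smul_eq_mul, ENNReal.ofReal_mul hz]
  gcongr
  calc ∫⁻ s, ‖s‖ₑ ∂r ≤ ∫⁻ s, ENNReal.ofReal c ∂r := lintegral_mono_ae (by
        filter_upwards [hbd] with s hs
        rw [Real.enorm_eq_ofReal_abs]
        exact ENNReal.ofReal_le_ofReal hs)
    _ = ENNReal.ofReal c := by simp

/-! ### Jointly measurable versions of `L¹`-valued maps -/

section Version

variable {X Ω : Type*} [MeasurableSpace X] [MeasurableSpace Ω] {Q : Measure Ω}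

open scoped ENNReal in
/-- A continuous map from a separable space to `L¹(Q)` has a jointly measurable version: at the
`n`-th stage `x` is replaced by a point of a dense sequence at which the values differ by less than
`2⁻ⁿ`, and these approximations converge almost surely for each fixed `x`. -/
theorem exists_measurable_version [TopologicalSpace X] [OpensMeasurableSpace X]
    [TopologicalSpace.SeparableSpace X] [Nonempty X] {Φ : X → Lp ℝ 1 Q} (hΦ : Continuous Φ) :
    ∃ h : X → Ω → ℝ, Measurable (Function.uncurry h) ∧ ∀ x, h x =ᵐ[Q] Φ x := by
  let a : ℕ → X := TopologicalSpace.denseSeq X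
  have hex : ∀ (n : ℕ) (x : X), ∃ k, edist (Φ (a k)) (Φ x) < (2⁻¹ : ℝ≥0∞) ^ n := fun n x => by
    have ho : IsOpen {y | edist (Φ y) (Φ x) < (2⁻¹ : ℝ≥0∞) ^ n} :=
      isOpen_lt (hΦ.edist continuous_const) continuous_const
    have hpos : (0 : ℝ≥0∞) < 2⁻¹ ^ n := ENNReal.pow_pos (by simp) n
    obtain ⟨y, hy, k, rfl⟩ := (TopologicalSpace.denseRange_denseSeq X).inter_open_nonempty _ ho
      ⟨x, by simpa using hpos⟩
    exact ⟨k, hy⟩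
  classical
  let κ : ℕ → X → ℕ := fun n x => Nat.find (hex n x)
  have hκ : ∀ n x, edist (Φ (a (κ n x))) (Φ x) < (2⁻¹ : ℝ≥0∞) ^ n := fun n x =>
    Nat.find_spec (hex n x)
  have hκm : ∀ n, Measurable (κ n) := fun n => measurable_find (hex n) fun k =>
    (isOpen_lt (continuous_const.edist hΦ) continuous_const).measurableSet
  let H : ℕ → X → Ω → ℝ := fun n x ω => Φ (a (κ n x)) ω
  have hHm : ∀ n, Measurable (Function.uncurry (H n)) := fun n => by
    have h1 : Measurable fun p : ℕ × Ω => Φ (a p.1) p.2 :=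
      measurable_from_prod_countable_right fun k =>
        (Lp.stronglyMeasurable (Φ (a k))).measurable
    exact h1.comp (((hκm n).comp measurable_fst).prodMk measurable_snd)
  refine ⟨fun x ω => limUnder atTop fun n => H n x ω, ?_, fun x => ?_⟩
  · exact (StronglyMeasurable.limUnder (l := atTop) (f := fun n => Function.uncurry (H n))
      fun n => (hHm n).stronglyMeasurable).measurable
  · have hconv : ∀ᵐ ω ∂Q, ∃ l : ℝ, Tendsto (fun n => H n x ω) atTop (𝓝 l) := by
      refine Lp.ae_tendsto_of_cauchy_eLpNorm (p := 1) (B := fun N => 2 * (2⁻¹ : ℝ≥0∞) ^ N)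
        (fun n => (Lp.aestronglyMeasurable _)) le_rfl ?_ fun N n m hn hm => ?_
      · rw [ENNReal.tsum_mul_left, ENNReal.tsum_geometric]
        simp [ENNReal.mul_eq_top]
      · change eLpNorm (⇑(Φ (a (κ n x))) - ⇑(Φ (a (κ m x)))) 1 Q < _
        rw [← Lp.edist_def]
        calc edist (Φ (a (κ n x))) (Φ (a (κ m x)))
            ≤ edist (Φ (a (κ n x))) (Φ x) + edist (Φ (a (κ m x))) (Φ x) :=
            edist_triangle_right _ _ _
          _ < (2⁻¹ : ℝ≥0∞) ^ n + 2⁻¹ ^ m := ENNReal.add_lt_add (hκ n x) (hκ m x)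
          _ ≤ 2⁻¹ ^ N + 2⁻¹ ^ N :=
            add_le_add (pow_le_pow_right_of_le_one' (by simp) hn)
              (pow_le_pow_right_of_le_one' (by simp) hm)
          _ = 2 * 2⁻¹ ^ N := (two_mul _).symm
    have hmeas : TendstoInMeasure Q (fun n => H n x) atTop (Φ x) := by
      refine tendstoInMeasure_of_tendsto_eLpNorm one_ne_zero (fun n => Lp.aestronglyMeasurable _)
        (Lp.aestronglyMeasurable _) ?_
      refine tendsto_of_tendsto_of_tendsto_of_le_of_le tendsto_const_nhds
        (ENNReal.tendsto_pow_atTop_nhds_zero_of_lt_one (r := 2⁻¹) (by simp)) (fun _ => zero_le)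
        fun n => ?_
      change eLpNorm (⇑(Φ (a (κ n x))) - ⇑(Φ x)) 1 Q ≤ _
      rw [← Lp.edist_def]
      exact (hκ n x).le
    obtain ⟨ns, hns, hlim⟩ := hmeas.exists_seq_tendsto_ae
    filter_upwards [hconv, hlim] with ω h1 h2
    obtain ⟨l, hl⟩ := h1
    rw [hl.limUnder_eq]
    exact tendsto_nhds_unique (hl.comp hns.tendsto_atTop) h2

variable {μ : Measure X} {Φ : X → Lp ℝ 1 Q} {h : X → Ω → ℝ}

theorem integrable_uncurry_version [SFinite Q] (hΦ : Integrable Φ μ)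
    (hm : Measurable (Function.uncurry h)) (hh : ∀ᵐ x ∂μ, h x =ᵐ[Q] Φ x) :
    Integrable (Function.uncurry h) (μ.prod Q) := by
  rw [integrable_prod_iff hm.aestronglyMeasurable]
  constructor
  · filter_upwards [hh] with x hx
    exact (L1.integrable_coeFn (Φ x)).congr hx.symm
  · refine hΦ.norm.congr ?_
    filter_upwards [hh] with x hx
    rw [L1.norm_eq_integral_norm]
    refine integral_congr_ae ?_
    filter_upwards [hx] with ω hω
    simp [Function.uncurry, hω]

/-- The Bochner integral of an `L¹(Q)`-valued map may be computed pointwise, from any jointly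
measurable version. -/
theorem coeFn_integral_eq_integral_version [SFinite μ] [SigmaFinite Q] (hΦ : Integrable Φ μ)
    (hm : Measurable (Function.uncurry h)) (hh : ∀ᵐ x ∂μ, h x =ᵐ[Q] Φ x) :
    ⇑(∫ x, Φ x ∂μ) =ᵐ[Q] fun ω => ∫ x, h x ω ∂μ := by
  have hint := integrable_uncurry_version hΦ hm hh
  refine Integrable.ae_eq_of_forall_setIntegral_eq _ _ (L1.integrable_coeFn _)
    hint.integral_prod_right fun s hs _ => ?_
  let L : Lp ℝ 1 Q →L[ℝ] ℝ := LinearMap.mkContinuous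
    { toFun := fun φ => ∫ ω in s, φ ω ∂Q
      map_add' := fun φ ψ => by
        rw [← integral_add (L1.integrable_coeFn φ).integrableOn
          (L1.integrable_coeFn ψ).integrableOn]
        exact integral_congr_ae (ae_restrict_of_ae (Lp.coeFn_add φ ψ))
      map_smul' := fun c φ => by
        rw [RingHom.id_apply, smul_eq_mul, ← integral_const_mul]
        exact integral_congr_ae (ae_restrict_of_ae (Lp.coeFn_smul c φ)) } 1 fun φ => by
      rw [one_mul, L1.norm_eq_integral_norm]
      exact (norm_integral_le_integral_norm _).trans
        (setIntegral_le_integral (L1.integrable_coeFn φ).norm (.of_forall fun _ => norm_nonneg _))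
  have h1 : ∫ ω in s, (∫ x, Φ x ∂μ : Lp ℝ 1 Q) ω ∂Q = ∫ x, L (Φ x) ∂μ :=
    (L.integral_comp_comm hΦ).symm
  rw [h1, ← integral_integral_swap (f := h)
    (hint.mono_measure (Measure.prod_mono le_rfl Measure.restrict_le_self))]
  refine integral_congr_ae ?_
  filter_upwards [hh] with x hx
  exact integral_congr_ae (ae_restrict_of_ae hx.symm)

end Version

/-! ### Random functionals with an integrable density -/

section Density

variable {d : ℕ} {E : Type*} [NormedAddCommGroup E] [NormedSpace ℝ E]
  {Γ : Space d → E}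

theorem integrable_schwartz_smul (hΓ : Continuous Γ) {M : ℝ} (hM : ∀ x, ‖Γ x‖ ≤ M) (f : TestFn d) :
    Integrable fun x => f x • Γ x := by
  refine (f.integrable (μ := volume)).smul_bdd M hΓ.aestronglyMeasurable (.of_forall hM)

/-- The superposition `f ↦ ∫ f(x) Γ(x) dx` of a bounded continuous family of vectors. -/
def superposition (hΓ : Continuous Γ) {M : ℝ} (hM : ∀ x, ‖Γ x‖ ≤ M) : TestFn d →ₗ[ℝ] E where
  toFun f := ∫ x, f x • Γ x
  map_add' f g := by
    simp only [_root_.add_apply, add_smul]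
    exact integral_add (integrable_schwartz_smul hΓ hM f) (integrable_schwartz_smul hΓ hM g)
  map_smul' c f := by
    simp only [_root_.smul_apply, smul_eq_mul, mul_smul, RingHom.id_apply]
    exact integral_smul c _

variable [CompleteSpace E]

open scoped ContDiff in
/-- Superpositions with bump functions concentrated near `x` converge to `Γ(x)`. -/
theorem mem_closure_range_superposition (hΓ : Continuous Γ) {M : ℝ} (hM : ∀ x, ‖Γ x‖ ≤ M)
    (x : Space d) : Γ x ∈ closure (range (superposition hΓ hM)) := by
  let φ : ℕ → ContDiffBump (0 : Space d) := fun n =>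
    ⟨1 / (n + 1), 2 / (n + 1), by positivity, by gcongr; norm_num⟩
  have hφ : Tendsto (fun n => (φ n).rOut) atTop (𝓝 0) := by
    have := (tendsto_one_div_add_atTop_nhds_zero_nat (𝕜 := ℝ)).const_mul 2
    simpa [φ, div_eq_mul_inv] using this
  refine mem_closure_of_tendsto
    (ContDiffBump.convolution_tendsto_right_of_continuous (μ := volume) hφ hΓ x)
    (.of_forall fun n => ?_)
  have hsm : ContDiff ℝ ∞ fun y => (φ n).normed volume (x - y) :=
    (φ n).contDiff_normed.comp (contDiff_const.sub contDiff_id)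
  have hcs : HasCompactSupport fun y => (φ n).normed volume (x - y) :=
    (φ n).hasCompactSupport_normed.comp_homeomorph (Homeomorph.subLeft x)
  refine ⟨hcs.toSchwartzMap hsm, ?_⟩
  rw [convolution_def, ← integral_sub_left_eq_self _ volume x]
  simp [superposition]

variable {Ω : Type*} [MeasurableSpace Ω] {Q : Measure Ω} [IsProbabilityMeasure Q]

/-- A random functional `J` on test functions, bounded in `L¹(Q)` by the norm of the superposition
`∫ f(x) Γ(x) dx`, has a jointly measurable density: formally, `h(x, ·)` is the value of `J` at the
vector `Γ(x)`. Here `J` extends to the closed span of the superpositions, which contains every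
`Γ(x)`. -/
theorem exists_density (hΓ : Continuous Γ) {M : ℝ} (hM : ∀ x, ‖Γ x‖ ≤ M)
    (J : TestFn d →ₗ[ℝ] Lp ℝ 1 Q) {C : ℝ} (hJ : ∀ f, ‖J f‖ ≤ C * ‖∫ x, f x • Γ x‖) :
    ∃ h : Space d → Ω → ℝ, Measurable (Function.uncurry h) ∧
      (∀ w : Space d → ℝ, Measurable w → Integrable w →
        Integrable (fun p : Space d × Ω => w p.1 * h p.1 p.2) (volume.prod Q)) ∧
      ∀ f : TestFn d, J f =ᵐ[Q] fun ω => ∫ x, f x * h x ω := by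
  let e := superposition hΓ hM
  let V : Submodule ℝ E := (LinearMap.range e).topologicalClosure
  have : CompleteSpace V := (Submodule.isClosed_topologicalClosure _).completeSpace_coe
  have heV : ∀ f, e f ∈ V := fun f => Submodule.le_topologicalClosure _ ⟨f, rfl⟩
  let e' : TestFn d →ₗ[ℝ] V := e.codRestrict V heV
  have hdense : DenseRange e' := by
    rw [DenseRange, dense_iff_closure_eq, Set.eq_univ_iff_forall]
    intro v
    rw [closure_subtype, ← range_comp]
    exact v.2
  let T : V →L[ℝ] Lp ℝ 1 Q := J.extendOfNorm e'
  have hTe : ∀ f, T (e' f) = J f := fun f => LinearMap.extendOfNorm_eq hdense ⟨C, hJ⟩ f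
  let Γ' : Space d → V := fun x => ⟨Γ x, mem_closure_range_superposition hΓ hM x⟩
  have hΓ' : Continuous Γ' := hΓ.subtype_mk _
  have hM' : ∀ x, ‖Γ' x‖ ≤ M := hM
  have hΦ : Continuous fun x => T (Γ' x) := T.continuous.comp hΓ'
  obtain ⟨h, hm, hh⟩ := exists_measurable_version hΦ
  have hwint : ∀ w : Space d → ℝ, Integrable w → Integrable fun x => w x • T (Γ' x) := fun w hw =>
    hw.smul_bdd (‖T‖ * M) hΦ.aestronglyMeasurable
      (.of_forall fun x => (T.le_opNorm _).trans (by gcongr; exact hM' x))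
  have hwm : ∀ w : Space d → ℝ, Measurable w →
      Measurable (Function.uncurry fun x ω => w x * h x ω) := fun w hw =>
    (hw.comp measurable_fst).mul hm
  have hwv : ∀ w : Space d → ℝ, ∀ᵐ x, (fun ω => w x * h x ω) =ᵐ[Q] (w x • T (Γ' x) : Lp ℝ 1 Q) :=
    fun w => .of_forall fun x => by
      filter_upwards [hh x, Lp.coeFn_smul (w x) (T (Γ' x))] with ω h1 h2
      rw [h2, h1]; rfl
  refine ⟨h, hm, fun w hw hwi => integrable_uncurry_version (hwint w hwi) (hwm w hw) (hwv w),
    fun f => ?_⟩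
  have h1 : J f = ∫ x, f x • T (Γ' x) := by
    rw [← hTe]
    have h2 : e' f = ∫ x, f x • Γ' x := by
      apply Subtype.ext
      change ∫ x, f x • Γ x = V.subtypeL (∫ x, f x • Γ' x)
      rw [← V.subtypeL.integral_comp_comm (integrable_schwartz_smul hΓ' hM' f)]
      rfl
    rw [h2, ← T.integral_comp_comm (integrable_schwartz_smul hΓ' hM' f)]
    simp_rw [map_smul]
  rw [h1]
  exact coeFn_integral_eq_integral_version (hwint f f.integrable) (hwm f f.continuous.measurable)
    (hwv f)

end Density

/-! ### The convolution kernel -/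

section Kernel

variable {d : ℕ} {G : Space d → ℝ}

/-- The reflected translates `y ↦ G (x - y)` of an integrable kernel, as elements of `L¹`. -/
def kernelTranslate (hG : Integrable G) (x : Space d) : Lp ℝ 1 (volume : Measure (Space d)) :=
  (hG.comp_sub_left x).toL1 fun y => G (x - y)

theorem norm_kernelTranslate (hG : Integrable G) (x : Space d) :
    ‖kernelTranslate hG x‖ = ∫ y, ‖G y‖ := by
  rw [kernelTranslate, L1.norm_of_fun_eq_integral_norm]
  exact integral_sub_left_eq_self (fun y => ‖G y‖) volume x

/-- Translation is continuous in `L¹`. -/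
theorem continuous_kernelTranslate (hG : Integrable G) : Continuous (kernelTranslate hG) := by
  have hG' : MemLp (fun y => G (-y)) 1 (volume : Measure (Space d)) :=
    memLp_one_iff_integrable.2 hG.comp_neg
  have : kernelTranslate hG = fun x : Space d =>
      DomAddAct.mk (-x) +ᵥ hG'.toLp (fun y => G (-y)) := by
    funext x
    rw [DomAddAct.mk_vadd_toLp]
    have : (fun y => G (x - y)) = fun y => G (-(-x +ᵥ y)) := by
      funext y; congr 1; simp [sub_eq_add_neg, add_comm]
    unfold kernelTranslate
    simp_rw [this]
    rfl
  rw [this]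
  have : Fact ((1 : ENNReal) ≠ ⊤) := ⟨ENNReal.one_ne_top⟩
  exact (DomAddAct.continuous_mk.comp continuous_neg).vadd continuous_const

theorem dualConv_eq (f : TestFn d) (y : Space d) :
    dualConv G f y = ∫ x, f x * G (x - y) := by
  rw [dualConv, ← integral_add_left_eq_self (fun x => f x * G (x - y)) y]
  simp [mul_comm]

theorem dualConv_congr {G' : Space d → ℝ} (h : G =ᵐ[volume] G') (f : TestFn d) :
    dualConv G f = dualConv G' f := by
  funext x
  exact integral_congr_ae (h.mono fun y hy => by simp [hy])

/-- The convolution of a test function with the reflected kernel is a superposition of reflected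
translates of the kernel. -/
theorem coeFn_integral_kernelTranslate (hG : Integrable G) (f : TestFn d) :
    ⇑(∫ x, f x • kernelTranslate hG x) =ᵐ[volume] dualConv G f := by
  let G' : Space d → ℝ := hG.1.mk G
  have hGG' : G =ᵐ[volume] G' := hG.1.ae_eq_mk
  have hG'm : Measurable G' := hG.1.stronglyMeasurable_mk.measurable
  have hm : Measurable (Function.uncurry fun x y : Space d => f x * G' (x - y)) :=
    (f.continuous.measurable.comp measurable_fst).mul
      (hG'm.comp (measurable_fst.sub measurable_snd))
  have hae : ∀ x : Space d, (fun y => G (x - y)) =ᵐ[volume] fun y => G' (x - y) := fun x =>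
    (Measure.measurePreserving_sub_left volume x).quasiMeasurePreserving.ae_eq_comp hGG'
  have := coeFn_integral_eq_integral_version (μ := volume) (Q := volume)
    (integrable_schwartz_smul (continuous_kernelTranslate hG)
      (fun x => (norm_kernelTranslate hG x).le) f) hm (.of_forall fun x => by
      filter_upwards [Lp.coeFn_smul (f x) (kernelTranslate hG x),
        (hG.comp_sub_left x).coeFn_toL1, hae x] with y h1 h2 h3
      rw [h1, Pi.smul_apply, smul_eq_mul, kernelTranslate, h2, h3])
  refine this.trans (.of_forall fun y => ?_)
  rw [dualConv_congr hGG', dualConv_eq]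

end Kernel

/-! ### Measurability of maps to `L¹` -/

section MeasurableToL1

variable {X Ω : Type*} [MeasurableSpace X] {μ : Measure X} {h : X → Ω → ℝ}

open Classical in
/-- The section `h(·, ω)` as an element of `L¹(μ)`, and `0` if it is not integrable. -/
def sectionL1 (μ : Measure X) (h : X → Ω → ℝ) (ω : Ω) : Lp ℝ 1 μ :=
  if hω : Integrable (fun x => h x ω) μ then hω.toL1 _ else 0

theorem coeFn_sectionL1 {ω : Ω} (hω : Integrable (fun x => h x ω) μ) :
    sectionL1 μ h ω =ᵐ[μ] fun x => h x ω := by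
  rw [sectionL1, dif_pos hω]
  exact hω.coeFn_toL1

variable [MeasurableSpace Ω]

theorem measurableSet_integrable_section [SFinite μ] (hm : Measurable (Function.uncurry h)) :
    MeasurableSet {ω | Integrable (fun x => h x ω) μ} :=
  measurableSet_integrable (f := fun ω x => h x ω) (hm.comp measurable_swap).stronglyMeasurable

/-- The map `ω ↦ h(·, ω)` into the separable space `L¹(μ)` is Borel measurable, as the distance to
every fixed element is. -/
theorem measurableSet_preimage_sectionL1 [SFinite μ] [SecondCountableTopology (Lp ℝ 1 μ)]
    (hm : Measurable (Function.uncurry h)) {U : Set (Lp ℝ 1 μ)} (hU : IsOpen U) :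
    MeasurableSet (sectionL1 μ h ⁻¹' U) := by
  have hball : ∀ (φ : Lp ℝ 1 μ) (ε : ℝ), MeasurableSet (sectionL1 μ h ⁻¹' Metric.ball φ ε) := by
    intro φ ε
    have hS := measurableSet_integrable_section (μ := μ) hm
    have hφ : Measurable fun p : Ω × X => h p.2 p.1 - φ p.2 :=
      (hm.comp measurable_swap).sub ((Lp.stronglyMeasurable φ).measurable.comp measurable_snd)
    have hdist : Measurable fun ω => ∫ x, ‖h x ω - φ x‖ ∂μ :=
      (hφ.norm.stronglyMeasurable.integral_prod_right).measurable
    have heq : (fun ω => dist (sectionL1 μ h ω) φ) =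
        {ω | Integrable (fun x => h x ω) μ}.indicator
            (fun ω => ∫ x, ‖h x ω - φ x‖ ∂μ) +
          {ω | Integrable (fun x => h x ω) μ}ᶜ.indicator fun _ => dist 0 φ := by
      funext ω
      by_cases hω : Integrable (fun x => h x ω) μ
      · rw [Pi.add_apply, indicator_of_mem (by exact hω), indicator_of_notMem (by simpa using hω),
          add_zero, dist_eq_norm, L1.norm_eq_integral_norm]
        refine integral_congr_ae ?_
        filter_upwards [coeFn_sectionL1 hω, Lp.coeFn_sub (sectionL1 μ h ω) φ] with x h1 h2
        rw [h2, Pi.sub_apply, h1]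
      · rw [Pi.add_apply, indicator_of_notMem (by exact hω), indicator_of_mem (by exact hω),
          zero_add, sectionL1, dif_neg hω]
    have hm' : Measurable fun ω => dist (sectionL1 μ h ω) φ := by
      rw [heq]
      exact (hdist.indicator hS).add (measurable_const.indicator hS.compl)
    exact measurableSet_lt hm' measurable_const
  choose ε hε hεU using fun φ : U => Metric.isOpen_iff.mp hU φ φ.2
  obtain ⟨T, hT, hTU⟩ := TopologicalSpace.isOpen_iUnion_countable
    (fun φ : U => Metric.ball (φ : Lp ℝ 1 μ) (ε φ)) fun φ => Metric.isOpen_ball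
  have hUeq : U = ⋃ φ ∈ T, Metric.ball (φ : Lp ℝ 1 μ) (ε φ) := by
    rw [hTU]
    refine subset_antisymm (fun φ hφ => ?_) (iUnion_subset hεU)
    exact mem_iUnion.2 ⟨⟨φ, hφ⟩, Metric.mem_ball_self (hε _)⟩
  rw [hUeq]
  simp only [preimage_iUnion]
  exact MeasurableSet.biUnion hT fun φ _ => hball _ _

end MeasurableToL1

/-! ### Weighted `L¹` functions as tempered distributions -/

section Weight

variable {d : ℕ} {ε : ℝ}

theorem weight_pos (d : ℕ) (ε : ℝ) (x : Space d) : 0 < weight d ε x := by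
  have : 0 < 1 + ‖x‖ ^ 2 := by positivity
  exact Real.rpow_pos_of_pos this _

theorem continuous_weight (d : ℕ) (ε : ℝ) : Continuous (weight d ε) :=
  (continuous_const.add (continuous_norm.pow 2)).rpow_const fun x =>
    Or.inl (show 1 + ‖x‖ ^ 2 ≠ 0 by positivity)

theorem integrable_weight (d : ℕ) (hε : 0 < ε) : Integrable (weight d ε) := by
  have := integrable_rpow_neg_one_add_norm_sq (E := Space d) (μ := volume) (r := (d : ℝ) + ε)
    (by simpa using hε)
  exact this

/-- The measure `g_ε dx`. -/
def weightMeasure (d : ℕ) (ε : ℝ) : Measure (Space d) :=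
  volume.withDensity fun x => ENNReal.ofReal (weight d ε x)

theorem integrable_weightMeasure_iff {h : Space d → ℝ} :
    Integrable h (weightMeasure d ε) ↔ Integrable fun x => weight d ε x * h x := by
  rw [weightMeasure, integrable_withDensity_iff_integrable_smul₀'
    (continuous_weight d ε).measurable.ennreal_ofReal.aemeasurable (by simp)]
  simp [ENNReal.toReal_ofReal (weight_pos d ε _).le]

theorem integral_weightMeasure (h : Space d → ℝ) :
    ∫ x, h x ∂(weightMeasure d ε) = ∫ x, weight d ε x * h x := by
  rw [weightMeasure, integral_withDensity_eq_integral_toReal_smul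
    (continuous_weight d ε).measurable.ennreal_ofReal (by simp)]
  simp [ENNReal.toReal_ofReal (weight_pos d ε _).le]

instance : SFinite (weightMeasure d ε) :=
  inferInstanceAs (SFinite (volume.withDensity fun x => ENNReal.ofReal (weight d ε x)))

instance : SecondCountableTopology (Lp ℝ 1 (weightMeasure d ε)) :=
  have : Fact ((1 : ENNReal) ≠ ⊤) := ⟨ENNReal.one_ne_top⟩
  inferInstance

/-- Test functions are bounded by multiples of the weight. -/
theorem exists_bound_div_weight (d : ℕ) (ε : ℝ) :
    ∃ (s : Finset (ℕ × ℕ)) (C : ℝ), 0 ≤ C ∧ ∀ (f : TestFn d) (x : Space d),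
      ‖f x / weight d ε x‖ ≤ C * s.sup (schwartzSeminormFamily ℝ (Space d) ℝ) f := by
  obtain ⟨N, hN⟩ := exists_nat_ge ((d : ℝ) + ε)
  refine ⟨Finset.Iic (2 * N, 0), 2 ^ (2 * N), by positivity, fun f x => ?_⟩
  have h1 := SchwartzMap.one_add_le_sup_seminorm_apply (𝕜 := ℝ) (m := (2 * N, 0)) (k := 2 * N)
    (n := 0) le_rfl le_rfl f x
  rw [norm_iteratedFDeriv_zero] at h1
  refine le_trans ?_ h1
  have hb : (1 : ℝ) ≤ 1 + ‖x‖ ^ 2 := by nlinarith [sq_nonneg ‖x‖]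
  rw [norm_div, Real.norm_of_nonneg (weight_pos d ε x).le, div_eq_inv_mul, weight,
    ← Real.rpow_neg (by positivity)]
  gcongr
  calc (1 + ‖x‖ ^ 2) ^ (-(-((d : ℝ) + ε) / 2)) ≤ (1 + ‖x‖ ^ 2) ^ ((N : ℝ)) := by
        refine Real.rpow_le_rpow_of_exponent_le hb ?_
        have : (0 : ℝ) ≤ N := N.cast_nonneg
        linarith
    _ = (1 + ‖x‖ ^ 2) ^ N := Real.rpow_natCast _ _
    _ ≤ ((1 + ‖x‖) ^ 2) ^ N := by
        gcongr
        nlinarith [norm_nonneg x]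
    _ = (1 + ‖x‖) ^ (2 * N) := by rw [pow_mul]

theorem integrable_mul_div_weight (φ : Lp ℝ 1 (weightMeasure d ε)) (f : TestFn d) :
    Integrable (fun x => φ x * (f x / weight d ε x)) (weightMeasure d ε) := by
  obtain ⟨s, C, -, hC⟩ := exists_bound_div_weight d ε
  exact (L1.integrable_coeFn φ).mul_bdd
    (f.continuous.div₀ (continuous_weight d ε) fun x => (weight_pos d ε x).ne').aestronglyMeasurable
    (.of_forall (hC f))

/-- The tempered distribution given by a function in `L¹(g_ε dx)`. The pairing `∫ φ f dx` is written
as `∫ φ (f / g_ε) g_ε dx`. -/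
def weightedDistribution (φ : Lp ℝ 1 (weightMeasure d ε)) : Tempered d :=
  SchwartzMap.mkCLMtoNormedSpace (𝕜 := ℝ) (σ := RingHom.id ℝ)
    (fun f : TestFn d => ∫ x, φ x * (f x / weight d ε x) ∂(weightMeasure d ε))
    (fun f g => by
      rw [← integral_add (integrable_mul_div_weight φ f) (integrable_mul_div_weight φ g)]
      congr 1 with x
      simp only [_root_.add_apply]
      ring)
    (fun a f => by
      rw [RingHom.id_apply, smul_eq_mul, ← integral_const_mul]
      congr 1 with x
      simp only [_root_.smul_apply, smul_eq_mul]
      ring)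
    (by
      obtain ⟨s, C, hC0, hC⟩ := exists_bound_div_weight d ε
      refine ⟨s, ‖φ‖ * C, by positivity, fun f => ?_⟩
      rw [L1.norm_eq_integral_norm, mul_assoc, ← integral_mul_const]
      refine norm_integral_le_of_norm_le ((L1.integrable_coeFn φ).norm.mul_const _)
        (.of_forall fun x => ?_)
      rw [norm_mul]
      gcongr
      exact hC f x)

theorem weightedDistribution_apply (φ : Lp ℝ 1 (weightMeasure d ε)) (f : TestFn d) :
    weightedDistribution φ f = ∫ x, φ x * (f x / weight d ε x) ∂(weightMeasure d ε) := rfl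

theorem continuous_weightedDistribution :
    Continuous (weightedDistribution : Lp ℝ 1 (weightMeasure d ε) → Tempered d) := by
  refine PointwiseConvergenceCLM.continuous_of_continuous_eval fun f => ?_
  obtain ⟨s, C, hC0, hC⟩ := exists_bound_div_weight d ε
  set M := C * s.sup (schwartzSeminormFamily ℝ (Space d) ℝ) f
  refine (LipschitzWith.of_dist_le' (K := M) fun φ ψ => ?_).continuous
  rw [weightedDistribution_apply, weightedDistribution_apply, dist_eq_norm,
    ← integral_sub (integrable_mul_div_weight φ f) (integrable_mul_div_weight ψ f),
    dist_eq_norm, L1.norm_eq_integral_norm, mul_comm, ← integral_mul_const]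
  refine norm_integral_le_of_norm_le ((L1.integrable_coeFn (φ - ψ)).norm.mul_const _) ?_
  filter_upwards [Lp.coeFn_sub φ ψ] with x hx
  rw [hx, Pi.sub_apply, ← sub_mul, norm_mul]
  gcongr
  exact hC f x

/-- The distribution of an element of `L¹(g_ε dx)` is given by any function in its class. -/
theorem isRepresentedBy_weightedDistribution {φ : Lp ℝ 1 (weightMeasure d ε)} {h : Space d → ℝ}
    (hφ : φ =ᵐ[weightMeasure d ε] h) : IsRepresentedBy (weightedDistribution φ) h := by
  intro f
  have hw : ∀ x, weight d ε x * (h x * (f x / weight d ε x)) = h x * f x := fun x => by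
    field_simp [(weight_pos d ε x).ne']
  have hae : (fun x => φ x * (f x / weight d ε x)) =ᵐ[weightMeasure d ε]
      fun x => h x * (f x / weight d ε x) := hφ.mono fun x hx => by simp only [hx]
  constructor
  · have := integrable_weightMeasure_iff.1 ((integrable_mul_div_weight φ f).congr hae)
    simpa only [hw] using this
  · rw [weightedDistribution_apply, integral_congr_ae hae, integral_weightMeasure]
    simp only [hw]

theorem locallyIntegrable_of_integrable_weightMeasure {h : Space d → ℝ}
    (hh : Integrable h (weightMeasure d ε)) : LocallyIntegrable h := by
  have h1 := (integrable_weightMeasure_iff.1 hh).locallyIntegrable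
  have h2 := h1.continuous_mul (g := fun x => (weight d ε x)⁻¹)
    ((continuous_weight d ε).inv₀ fun x => (weight_pos d ε x).ne')
  refine h2.congr (.of_forall fun x => ?_)
  simp only
  rw [inv_mul_cancel_left₀ (weight_pos d ε x).ne']

end Weight

/-! ### The noise as a bounded operator on `L¹` -/

section Noise

variable {d : ℕ} {Q : Measure (Tempered d)}

/-- The coordinate process of an integrable random distribution, as a linear map to `L¹(Q)`. -/
def coordinateL1 (hQ : ∀ f : TestFn d, Integrable (fun η : Tempered d => η f) Q) :
    TestFn d →ₗ[ℝ] Lp ℝ 1 Q where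
  toFun f := (hQ f).toL1 fun η => η f
  map_add' f g := by
    rw [← Integrable.toL1_add]
    congr 1
    funext η
    exact map_add η f g
  map_smul' c f := by
    rw [RingHom.id_apply, ← Integrable.toL1_smul']
    congr 1
    funext η
    exact map_smul η c f

theorem coeFn_coordinateL1 (hQ : ∀ f : TestFn d, Integrable (fun η : Tempered d => η f) Q)
    (f : TestFn d) : coordinateL1 hQ f =ᵐ[Q] fun η => η f :=
  (hQ f).coeFn_toL1

theorem norm_coordinateL1 (hQ : ∀ f : TestFn d, Integrable (fun η : Tempered d => η f) Q)
    (f : TestFn d) : ‖coordinateL1 hQ f‖ = (∫⁻ η, ‖η f‖ₑ ∂Q).toReal := by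
  change ‖(hQ f).toL1 _‖ = _
  rw [Integrable.norm_toL1_eq_lintegral_enorm]

/-- The Poisson noise extends to a bounded operator from `L¹(dx)` to `L¹(P)`. -/
theorem IsPoissonWhiteNoise.exists_extension {z : ℝ} (hz : 0 ≤ z) {r : Measure ℝ}
    (hr : IsProbabilityMeasure r) {c : ℝ} (hrc : r.support ⊆ Set.Icc (-c) c)
    {P : Measure (Tempered d)} (hP : IsPoissonWhiteNoise z r P) :
    ∃ T : Lp ℝ 1 (volume : Measure (Space d)) →L[ℝ] Lp ℝ 1 P,
      ∀ u : TestFn d, T (u.toLp 1 volume) =ᵐ[P] fun ω => ω u := by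
  have hfin : ∀ u : TestFn d, ∫⁻ x, ‖u x‖ₑ ≠ ⊤ := fun u => u.integrable.2.ne
  have hint : ∀ u : TestFn d, Integrable (fun ω : Tempered d => ω u) P := fun u =>
    ⟨(measurable_tempered_apply u).aestronglyMeasurable,
      (hP.lintegral_enorm_le hz hr hrc u).trans_lt
        (ENNReal.mul_lt_top ENNReal.ofReal_lt_top (hfin u).lt_top)⟩
  have hbd : ∀ u : TestFn d, ‖coordinateL1 hint u‖ ≤
      (ENNReal.ofReal (z * c)).toReal * ‖(SchwartzMap.toLpCLM ℝ ℝ 1 volume).toLinearMap u‖ := by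
    intro u
    rw [norm_coordinateL1]
    have h1 : ‖(SchwartzMap.toLpCLM ℝ ℝ 1 volume).toLinearMap u‖ = (∫⁻ x, ‖u x‖ₑ).toReal := by
      change ‖u.toLp 1 volume‖ = _
      rw [SchwartzMap.norm_toLp, eLpNorm_one_eq_lintegral_enorm]
    rw [h1, ← ENNReal.toReal_mul]
    exact ENNReal.toReal_mono (ENNReal.mul_ne_top ENNReal.ofReal_ne_top (hfin u))
      (hP.lintegral_enorm_le hz hr hrc u)
  refine ⟨(coordinateL1 hint).extendOfNorm (SchwartzMap.toLpCLM ℝ ℝ 1 volume).toLinearMap,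
    fun u => ?_⟩
  have hu : (coordinateL1 hint).extendOfNorm (SchwartzMap.toLpCLM ℝ ℝ 1 volume).toLinearMap
      (u.toLp 1 volume) = coordinateL1 hint u :=
    LinearMap.extendOfNorm_eq (SchwartzMap.denseRange_toLpCLM ENNReal.one_ne_top) ⟨_, hbd⟩ u
  rw [hu]
  exact coeFn_coordinateL1 hint u

variable {P : Measure (Tempered d)} {G : Space d → ℝ}
  {T : Lp ℝ 1 (volume : Measure (Space d)) →L[ℝ] Lp ℝ 1 P}

/-- The convergence in the definition of `G * F` is convergence in `L¹` to the superposition of the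
translated kernels. -/
theorem tendsto_toLp_iff (hG : Integrable G) (f : TestFn d) (u : ℕ → TestFn d) :
    Tendsto (fun n => eLpNorm (fun x => u n x - dualConv G f x) 1 volume) atTop (𝓝 0) ↔
      Tendsto (fun n => (u n).toLp 1 volume) atTop (𝓝 (∫ x, f x • kernelTranslate hG x)) := by
  rw [tendsto_iff_edist_tendsto_0]
  refine tendsto_congr fun n => ?_
  rw [Lp.edist_def]
  refine eLpNorm_congr_ae ?_
  filter_upwards [(u n).coeFn_toLp 1 volume, coeFn_integral_kernelTranslate hG f] with x h1 h2
  rw [Pi.sub_apply, h1, h2]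

theorem tendstoInMeasure_apply
    (hT : ∀ u : TestFn d, T (u.toLp 1 volume) =ᵐ[P] fun ω => ω u) {u : ℕ → TestFn d}
    {φ : Lp ℝ 1 (volume : Measure (Space d))}
    (hu : Tendsto (fun n => (u n).toLp 1 volume) atTop (𝓝 φ)) :
    TendstoInMeasure P (fun n ω => ω (u n)) atTop (T φ) := by
  refine tendstoInMeasure_of_tendsto_eLpNorm one_ne_zero
    (fun n => (measurable_tempered_apply (u n)).aestronglyMeasurable)
    (Lp.aestronglyMeasurable _) ?_
  refine (tendsto_iff_edist_tendsto_0.1 ((T.continuous.tendsto φ).comp hu)).congr fun n => ?_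
  rw [Function.comp_apply, Lp.edist_def]
  exact eLpNorm_congr_ae ((hT (u n)).sub (ae_eq_refl _))

/-- The versions of `G * F` are the versions of the process `f ↦ T (∫ f(x) G(x - ·) dx)`. -/
theorem isConvolutedField_iff (hG : Integrable G)
    (hT : ∀ u : TestFn d, T (u.toLp 1 volume) =ᵐ[P] fun ω => ω u)
    {X : TestFn d → Tempered d → ℝ} :
    IsConvolutedField G P X ↔
      ∀ f, X f =ᵐ[P] T (∫ x, f x • kernelTranslate hG x) := by
  refine forall_congr' fun f => ⟨fun ⟨_, hX⟩ => ?_, fun hX => ⟨?_, fun u hu => ?_⟩⟩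
  · obtain ⟨v, hv, hvlim⟩ := mem_closure_iff_seq_limit.1
      (SchwartzMap.denseRange_toLpCLM (F := ℝ) (p := 1) (μ := (volume : Measure (Space d)))
        ENNReal.one_ne_top (∫ x, f x • kernelTranslate hG x))
    choose u hu using hv
    have hlim : Tendsto (fun n => (u n).toLp 1 volume) atTop
        (𝓝 (∫ x, f x • kernelTranslate hG x)) := by
      refine hvlim.congr fun n => (hu n).symm
    exact tendstoInMeasure_ae_unique (hX u ((tendsto_toLp_iff hG f u).2 hlim))
      (tendstoInMeasure_apply hT hlim)
  · exact (Lp.aestronglyMeasurable _).aemeasurable.congr hX.symm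
  · exact (tendstoInMeasure_apply hT ((tendsto_toLp_iff hG f u).1 hu)).congr_right hX.symm

/-- The convoluted field has a version with values in `L¹(g_ε dx)`, measurable as a map to the
tempered distributions because it factors through the separable Banach space `L¹(g_ε dx)`. -/
theorem exists_measurable_isConvolutedField [IsProbabilityMeasure P] (hG : Integrable G)
    (hT : ∀ u : TestFn d, T (u.toLp 1 volume) =ᵐ[P] fun ω => ω u) :
    ∃ X : Tempered d → Tempered d, Measurable X ∧ IsConvolutedField G P fun f ω => X ω f := by
  have hM : ∀ x, ‖kernelTranslate hG x‖ ≤ ∫ y, ‖G y‖ := fun x => (norm_kernelTranslate hG x).le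
  obtain ⟨h, hm, hint, hrep⟩ := exists_density (Q := P) (continuous_kernelTranslate hG) hM
    (T.toLinearMap ∘ₗ superposition (continuous_kernelTranslate hG) hM) (C := ‖T‖)
    fun f => T.le_opNorm _
  refine ⟨fun ω => weightedDistribution (sectionL1 (weightMeasure d 1) h ω), ?_, ?_⟩
  · refine measurable_of_isOpen fun U hU => ?_
    exact measurableSet_preimage_sectionL1 hm (hU.preimage continuous_weightedDistribution)
  · rw [isConvolutedField_iff hG hT]
    intro f
    have h1 := (hint (weight d 1) (continuous_weight d 1).measurable
      (integrable_weight d one_pos)).prod_left_ae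
    filter_upwards [h1, hrep f] with ω hω hf
    have hω' := integrable_weightMeasure_iff.2 hω
    rw [(isRepresentedBy_weightedDistribution (coeFn_sectionL1 hω') f).2]
    refine Eq.trans ?_ hf.symm
    simp_rw [mul_comm]

/-- Every law of the convoluted field is carried by `L¹(g_ε dx)`. The law satisfies the same first
moment bounds as the field, so that its coordinate process has a density `h`; the distributions
that agree with their density on a countable dense set of test functions form a measurable set of
full measure. -/
theorem IsLawOfField.hasPathsIn_weightedL1 [IsProbabilityMeasure P] (hG : Integrable G)
    (hT : ∀ u : TestFn d, T (u.toLp 1 volume) =ᵐ[P] fun ω => ω u)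
    {X : TestFn d → Tempered d → ℝ} (hX : IsConvolutedField G P X) (hQ : IsLawOfField P X Q)
    {ε : ℝ} (hε : 0 < ε) : HasPathsIn Q (weightedL1 d ε) := by
  have := hQ.1
  have hXm : ∀ f, AEMeasurable (X f) P := fun f => (hX f).1
  rw [isConvolutedField_iff hG hT] at hX
  have hM : ∀ x, ‖kernelTranslate hG x‖ ≤ ∫ y, ‖G y‖ := fun x => (norm_kernelTranslate hG x).le
  let e := superposition (continuous_kernelTranslate hG) hM
  have hlaw : ∀ f, Q.map (fun η => η f) = P.map (X f) := by
    intro f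
    have : IsFiniteMeasure (P.map (X f)) := Measure.isFiniteMeasure_map _ _
    -- The characteristic function at `t` is the characteristic functional at `t • f`.
    refine Measure.ext_of_charFun (funext fun t => ?_)
    rw [charFun_apply_real, charFun_apply_real,
      integral_map (measurable_tempered_apply f).aemeasurable (by fun_prop),
      integral_map (hXm f) (by fun_prop)]
    have e1 : ∀ η : Tempered d, Complex.exp (t * (η f : ℝ) * Complex.I) =
        Complex.exp (Complex.I * ((η (t • f) : ℝ) : ℂ)) := fun η => by
      rw [map_smul, smul_eq_mul]; push_cast; ring_nf
    simp_rw [e1, hQ.2 (t • f)]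
    refine integral_congr_ae ?_
    have e2 : T (e (t • f)) = t • T (e f) := by rw [map_smul, map_smul]
    filter_upwards [hX f, hX (t • f), Lp.coeFn_smul t (T (e f))] with ω h1 h2 h3
    rw [h2, h1]
    change Complex.exp (Complex.I * ((T (e (t • f)) ω : ℝ) : ℂ)) = _
    rw [e2, h3, Pi.smul_apply, smul_eq_mul]
    push_cast
    simp only [e, superposition, LinearMap.coe_mk, AddHom.coe_mk]
    ring_nf
  have hmom : ∀ f, ∫⁻ η, ‖η f‖ₑ ∂Q = ∫⁻ ω, ‖T (e f) ω‖ₑ ∂P := by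
    intro f
    rw [← lintegral_map (f := fun x : ℝ => ‖x‖ₑ) (by fun_prop) (measurable_tempered_apply f),
      hlaw f, lintegral_map' (by fun_prop) (hXm f)]
    exact lintegral_congr_ae ((hX f).mono fun ω h => by simp only [h]; rfl)
  have hint : ∀ f : TestFn d, Integrable (fun η : Tempered d => η f) Q := fun f =>
    ⟨(measurable_tempered_apply f).aestronglyMeasurable, by
      rw [HasFiniteIntegral, hmom f]
      exact (L1.integrable_coeFn (T (e f))).2⟩
  obtain ⟨h, hm, hwint, hrep⟩ := exists_density (Q := Q) (continuous_kernelTranslate hG) hM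
    (coordinateL1 hint) (C := ‖T‖) fun f => by
      rw [norm_coordinateL1, hmom f]
      refine le_trans (le_of_eq ?_) (T.le_opNorm (e f))
      rw [L1.norm_def]
  -- A countable intersection is needed for `B` to be measurable; it suffices since both sides are
  -- continuous in the test function.
  obtain ⟨D, hDc, hD⟩ := TopologicalSpace.exists_countable_dense (TestFn d)
  let B : Set (Tempered d) := {η | Integrable (fun x => h x η) (weightMeasure d ε)} ∩
    ⋂ f ∈ D, {η | η f = ∫ x, f x * h x η}
  have hBm : MeasurableSet B := by
    refine (measurableSet_integrable_section hm).inter (MeasurableSet.biInter hDc fun f _ => ?_)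
    refine measurableSet_eq_fun (measurable_tempered_apply f) ?_
    have : Measurable fun p : Tempered d × Space d => f p.2 * h p.2 p.1 :=
      (f.continuous.measurable.comp measurable_snd).mul (hm.comp measurable_swap)
    exact this.stronglyMeasurable.integral_prod_right.measurable
  have hBQ : ∀ᵐ η ∂Q, η ∈ B := by
    have h1 := (hwint (weight d ε) (continuous_weight d ε).measurable
      (integrable_weight d hε)).prod_left_ae
    have h2 : ∀ᵐ η ∂Q, ∀ f ∈ D, η f = ∫ x, f x * h x η := by
      rw [ae_ball_iff hDc]
      intro f _
      filter_upwards [hrep f, coeFn_coordinateL1 hint f] with η h3 h4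
      rw [← h4, h3]
    filter_upwards [h1, h2] with η h3 h4
    exact ⟨integrable_weightMeasure_iff.2 h3, mem_iInter₂.2 h4⟩
  have hBE : B ⊆ weightedL1 d ε := by
    rintro η ⟨hη, hηD⟩
    have hr := isRepresentedBy_weightedDistribution (coeFn_sectionL1 hη)
    have heq : ∀ f, η f = weightedDistribution (sectionL1 (weightMeasure d ε) h η) f := by
      intro f
      have := Continuous.ext_on hD (map_continuous η)
        (map_continuous (weightedDistribution (sectionL1 (weightMeasure d ε) h η)))
        fun g hg => by
          rw [(hr g).2, mem_iInter₂.1 hηD g hg]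
          simp_rw [mul_comm]
      exact congrFun this f
    exact ⟨fun x => h x η, hη, fun f => ⟨(hr f).1, by rw [heq f, (hr f).2]⟩⟩
  refine le_antisymm (iSup_le fun _ => iSup_le fun _ => iSup_le fun _ => prob_le_one) ?_
  rw [← prob_compl_eq_zero_iff hBm |>.1 (by simpa [mem_ae_iff] using hBQ)]
  exact le_iSup_of_le B (le_iSup_of_le hBm (le_iSup_of_le hBE le_rfl))

theorem IsConvolutionOperator.continuous {K : Tempered d → Tempered d}
    (hK : IsConvolutionOperator G K) : Continuous K := by
  refine PointwiseConvergenceCLM.continuous_of_continuous_eval fun f => ?_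
  obtain ⟨h, -, hKf⟩ := hK f
  simpa only [hKf] using continuous_tempered_apply h

/-- The pathwise convolution is a version of the convoluted field, because `dualConv G f` is itself
a test function `h` and `T` agrees with the noise on test functions. -/
theorem IsConvolutionOperator.isConvolutedField {K : Tempered d → Tempered d}
    (hK : IsConvolutionOperator G K) (hG : Integrable G)
    (hT : ∀ u : TestFn d, T (u.toLp 1 volume) =ᵐ[P] fun ω => ω u) :
    IsConvolutedField G P fun f ω => K ω f := by
  rw [isConvolutedField_iff hG hT]
  intro f
  obtain ⟨h, hh, hKf⟩ := hK f
  have : h.toLp 1 volume = ∫ x, f x • kernelTranslate hG x := by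
    refine Lp.ext ?_
    filter_upwards [h.coeFn_toLp 1 volume, coeFn_integral_kernelTranslate hG f] with x h1 h2
    rw [h1, h2, hh]
  simp only [hKf, ← this]
  exact (hT h).symm

theorem isLawOfField_map [IsProbabilityMeasure P] {K : Tempered d → Tempered d}
    (hK : Measurable K) : IsLawOfField P (fun f ω => K ω f) (P.map K) := by
  refine ⟨Measure.isProbabilityMeasure_map hK.aemeasurable, fun f => ?_⟩
  rw [integral_map hK.aemeasurable]
  exact (Complex.measurable_exp.comp ((Complex.measurable_ofReal.comp
    (measurable_tempered_apply f)).const_mul _)).aestronglyMeasurable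

end Noise

end PoissonNoise

end

theorem theorem3p1 (d : ℕ) (hd : 1 ≤ d)
    (z : ℝ) (hz : 0 ≤ z)
    (r : Measure ℝ) (hr : IsProbabilityMeasure r) (hr0 : r {0} = 0)
    (c : ℝ) (hc : 0 < c) (hrc : r.support ⊆ Set.Icc (-c) c)
    (P : Measure (PoissonNoise.Tempered d)) (hP : PoissonNoise.IsPoissonWhiteNoise z r P)
    (G : PoissonNoise.Space d → ℝ) (hG : Integrable G) :
    -- the random field `G * F` exists, as a random tempered distribution
    (∃ X : PoissonNoise.Tempered d → PoissonNoise.Tempered d,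
      Measurable X ∧ PoissonNoise.IsConvolutedField G P (fun f ω => X ω f)) ∧
    -- every version of it has paths in the weighted `L¹` space
    (∀ (X : PoissonNoise.TestFn d → PoissonNoise.Tempered d → ℝ)
      (Q : Measure (PoissonNoise.Tempered d)),
      PoissonNoise.IsConvolutedField G P X → PoissonNoise.IsLawOfField P X Q →
        ∀ ε : ℝ, 0 < ε → PoissonNoise.HasPathsIn Q (PoissonNoise.weightedL1 d ε)) ∧
    -- if `ω ↦ G * ω` is defined on all tempered distributions, then the pathwise convolution is
    -- such a version, and its law has paths in the weighted `L¹` space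
    (∀ K : PoissonNoise.Tempered d → PoissonNoise.Tempered d,
      PoissonNoise.IsConvolutionOperator G K →
        Measurable K ∧ PoissonNoise.IsConvolutedField G P (fun f ω => K ω f) ∧
          ∀ ε : ℝ, 0 < ε → PoissonNoise.HasPathsIn (P.map K) (PoissonNoise.weightedL1 d ε)) ∧
    -- such paths are locally integrable functions
    (∀ ε : ℝ, 0 < ε → ∀ ω ∈ PoissonNoise.weightedL1 d ε,
      ∃ h : PoissonNoise.Space d → ℝ,
        LocallyIntegrable h ∧ PoissonNoise.IsRepresentedBy ω h) := by
  have := hP.1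
  obtain ⟨T, hT⟩ := hP.exists_extension hz hr hrc
  refine ⟨PoissonNoise.exists_measurable_isConvolutedField hG hT,
    fun X Q hX hQ ε hε => hQ.hasPathsIn_weightedL1 hG hT hX hε, fun K hK => ?_,
    fun ε _ ω ⟨h, hh, hω⟩ =>
      ⟨h, PoissonNoise.locallyIntegrable_of_integrable_weightMeasure hh, hω⟩⟩
  have hKX := hK.isConvolutedField hG hT
  exact ⟨hK.continuous.measurable, hKX, fun ε hε =>
    (PoissonNoise.isLawOfField_map hK.continuous.measurable).hasPathsIn_weightedL1 hG hT hKX hε⟩
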